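/- Let $A$ be a totally unimodular integer matrix with finitely many rows, indexed by $I$, and finitely many columns $v_e\in\mathbb{Z}^I$ ($e\in E$); that is, every square submatrix of $A$ has determinant in $\{0,1,-1\}$. Let $$Z=Z_A=\Big\{\sum_{e\in E}c_e v_e \;:\; 0\le c_e\le 1\Big\}\subseteq\mathbb{R}^I$$ be the zonotope of $A$, and let $M$ be the regular matroid on $E$ represented by $A$: a set $S\subseteq E$ is independent in $M$ if and only if the family $(v_e)_{e\in S}$ is linearly independent over $\mathbb{Q}$. Let $\mathrm{rk}$ be the rank function of $M$, let $\mathrm{rk}(M)=\mathrm{rk}(E)$, and let $$T_M(x,y)=\sum_{S\subseteq E}(x-1)^{\mathrm{rk}(E)-\mathrm{rk}(S)}(y-1)^{|S|-\mathrm{rk}(S)}$$ be the Tutte polynomial of $M$. Then for every positive integer $q$ the set $qZ\cap\mathbb{Z}^I$ of lattice points in the dilate $qZ=\{qz : z\in Z\}$ is finite, and $$\big|qZ\cap\mathbb{Z}^I\big| = q^{\mathrm{rk}(M)}\,T_M\Big(1+\frac1q,\,1\Big).$$ -/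

import Mathlib

open scoped Pointwise

/-- The matroid `M_F(A)` on the index set `E` of the columns of a matrix `A` over a field `F`: a set
of columns is independent iff the corresponding family of column vectors is linearly independent
over `F`. -/
noncomputable def columnMatroid {F ι E : Type*} [Field F] [Finite E] (A : Matrix ι E F) :
    Matroid E :=
  (IndepMatroid.ofFinite (E := Set.univ) Set.finite_univ
    (fun I : Set E => LinearIndepOn F A.col I)
    (linearIndepOn_empty F A.col)
    (fun _ _ hJ hIJ => hJ.mono hIJ)
    (by
      intro I J hI hJ hlt
      by_contra hcon
      push Not at hcon
      have hsub : A.col '' J ⊆ (Submodule.span F (A.col '' I) : Set (ι → F)) := by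
        rintro _ ⟨e, he, rfl⟩
        by_cases heI : e ∈ I
        · exact Submodule.subset_span ⟨e, heI, rfl⟩
        · by_contra hspan
          exact hcon e he heI ((linearIndepOn_insert heI).2 ⟨hI, hspan⟩)
      have hle : Submodule.span F (A.col '' J) ≤ Submodule.span F (A.col '' I) :=
        Submodule.span_le.2 hsub
      have hfin : ∀ K : Set E, LinearIndepOn F A.col K →
          Module.finrank F (Submodule.span F (A.col '' K)) = K.ncard := by
        intro K hK
        have := Fintype.ofFinite K
        have h := finrank_span_eq_card (R := F) hK
        rw [Set.image_eq_range, h, ← Nat.card_eq_fintype_card, Nat.card_coe_set_eq]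
      have hfd : FiniteDimensional F (Submodule.span F (A.col '' I)) :=
        FiniteDimensional.span_of_finite F (Set.toFinite _)
      have h := Submodule.finrank_mono hle
      rw [hfin I hI, hfin J hJ] at h
      omega)
    (fun I _ => Set.subset_univ I)).matroid

theorem columnMatroid_ground {F ι E : Type*} [Field F] [Finite E] (A : Matrix ι E F) :
    (columnMatroid A).E = Set.univ := rfl

theorem columnMatroid_indep_iff {F ι E : Type*} [Field F] [Finite E] (A : Matrix ι E F)
    (I : Set E) : (columnMatroid A).Indep I ↔ LinearIndepOn F A.col I := Iff.rfl

instance columnMatroid_finite {F ι E : Type*} [Field F] [Finite E] (A : Matrix ι E F) :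
    (columnMatroid A).Finite := ⟨Set.finite_univ⟩

/-- The rank of a set `X` in a matroid of finite rank, as a natural number. -/
noncomputable def Matroid.natRk {α : Type*} (M : Matroid α) (X : Set α) : ℕ := (M.eRk X).toNat

/-- The Tutte polynomial of a finite matroid,
`T_M(x, y) = ∑_{S ⊆ E} (x - 1) ^ (rk E - rk S) * (y - 1) ^ (|S| - rk S)`,
where the variables `x` and `y` are `X 0` and `X 1`. -/
noncomputable def Matroid.tuttePolynomial {α : Type*} (M : Matroid α) [M.Finite] :
    MvPolynomial (Fin 2) ℤ :=
  ∑ S ∈ M.ground_finite.toFinset.powerset,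
    (MvPolynomial.X 0 - 1) ^ (M.natRk M.E - M.natRk (S : Set α)) *
      (MvPolynomial.X 1 - 1) ^ (S.card - M.natRk (S : Set α))

/-- The (column) zonotope of an integer matrix `A` with columns `v_e`:
`Z_A = {∑ e, c_e v_e : 0 ≤ c_e ≤ 1}`. -/
def zonotope {ι E : Type*} [Fintype E] (A : Matrix ι E ℤ) : Set (ι → ℝ) :=
  {x | ∃ c : E → ℝ, (∀ e, 0 ≤ c e ∧ c e ≤ 1) ∧ x = ∑ e, c e • (A.map (Int.cast : ℤ → ℝ)).col e}

/-- The lattice points of a subset `P` of `ℝ^ι`, i.e. the points of `ℤ^ι` that lie in `P`. -/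
def latticePoints {ι : Type*} (P : Set (ι → ℝ)) : Set (ι → ℤ) :=
  {z | (fun i => (z i : ℝ)) ∈ P}

/-- The regular matroid represented over `ℚ` by a (totally unimodular) integer matrix. -/
noncomputable abbrev regularMatroid {ι E : Type*} [Finite E] (A : Matrix ι E ℤ) : Matroid E :=
  columnMatroid (A.map (Int.cast : ℤ → ℚ))

/-! Total unimodularity enters only through saturation: each set of columns spans a subgroup with
torsion-free quotient. Saturation passes to quotients by such spans, that is, to contractions. It
lets real coefficients of a lattice point be rounded to integers within integer bounds
(`exists_int_sum_eq`). Hence the lattice points of `qZ` are the sums of columns with integer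
coefficients in `[0, q]`. These are counted with a separate bound `m e` for each column. Lowering `m
e` by one removes exactly the top point on each line in direction `v e`, and these lines correspond
to the box sums of the contraction by `e` (`bijOn_mkQ_boxSums_diff`). The weighted count of
independent sets obeys the same recursion. For constant `m = q` it is the sum of `q ^ |S|` over
independent `S`, which is the Tutte polynomial on the line `y = 1`. -/

open scoped TensorProduct

/-! ### Saturated families and total unimodularity -/

/-- A family `v` in an abelian group is saturated if each subfamily spans a subgroup with
torsion-free quotient. -/
def IsSaturatedFamily {E L : Type*} [AddCommGroup L] (v : E → L) : Prop :=
  ∀ (S : Set E) (n : ℤ) (x : L), n ≠ 0 → n • x ∈ Submodule.span ℤ (v '' S) →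
    x ∈ Submodule.span ℤ (v '' S)

theorem IsSaturatedFamily.eq_zero_of_smul {E L : Type*} [AddCommGroup L] {v : E → L}
    (hv : IsSaturatedFamily v) {n : ℤ} {x : L} (hn : n ≠ 0) (h : n • x = 0) : x = 0 := by
  simpa using hv ∅ n x hn (by simp [h])

/-- The preimage of the span of `S` in the quotient is the span of `T ∪ S` in `L`. -/
theorem IsSaturatedFamily.quotient {E L : Type*} [AddCommGroup L] {v : E → L}
    (hv : IsSaturatedFamily v) (T : Set E) :
    IsSaturatedFamily ((Submodule.span ℤ (v '' T)).mkQ ∘ v) := by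
  intro S n x hn hx
  obtain ⟨x, rfl⟩ := Submodule.mkQ_surjective _ x
  rw [Set.image_comp, ← Submodule.map_span] at hx ⊢
  rw [← map_smul, ← Submodule.mem_comap, Submodule.comap_map_mkQ, ← Submodule.span_union,
    ← Set.image_union] at hx
  rw [← Submodule.mem_comap, Submodule.comap_map_mkQ, ← Submodule.span_union, ← Set.image_union]
  exact hv _ n x hn hx

theorem exists_injective_isUnit_submatrix {K m n : Type*} [Field K] [Finite m] [Fintype n]
    [DecidableEq n] (A : Matrix m n K) (hA : LinearIndependent K A.col) :
    ∃ r : n → m, IsUnit (A.submatrix r id) := by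
  have := Fintype.ofFinite m
  obtain ⟨κ, a, ha, hspan, hli⟩ := exists_linearIndependent' K A.row
  have : Finite κ := Finite.of_injective a ha
  have := Fintype.ofFinite κ
  have h1 := A.rank_eq_finrank_span_row
  rw [← hspan, finrank_span_eq_card hli, ← Matrix.rank_transpose,
    LinearIndependent.rank_matrix (M := A.transpose) hA] at h1
  obtain ⟨e⟩ := Fintype.card_eq.1 h1
  refine ⟨a ∘ e, ?_⟩
  rw [← Matrix.linearIndependent_rows_iff_isUnit]
  exact hli.comp e e.injective

theorem linearIndependent_map_intCast_col_iff {ι E : Type*} [Finite ι] (A : Matrix ι E ℤ) :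
    LinearIndependent ℚ (A.map (Int.cast : ℤ → ℚ)).col ↔ LinearIndependent ℤ A.col :=
  linearIndependent_algebraMap_comp_iff (R := ℤ) (S := ℚ) (v := A.col)

/-- A nonsingular square submatrix `N` on all columns has determinant ±1, so `N⁻¹` is integral and
the coefficients of `n • x` are divisible by `n`. -/
theorem Matrix.IsTotallyUnimodular.mem_span_of_smul_mem {ι E : Type*} [Finite ι] [Finite E]
    {A : Matrix ι E ℤ} (hA : A.IsTotallyUnimodular) (hli : LinearIndependent ℤ A.col)
    {n : ℤ} {x : ι → ℤ} (hn : n ≠ 0) (hx : n • x ∈ Submodule.span ℤ (Set.range A.col)) :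
    x ∈ Submodule.span ℤ (Set.range A.col) := by
  classical
  have := Fintype.ofFinite E
  obtain ⟨r, hr⟩ := exists_injective_isUnit_submatrix _
    ((linearIndependent_map_intCast_col_iff A).2 hli)
  have hdet : ((A.submatrix r id).det : ℚ) ≠ 0 := by
    rw [Int.cast_det]
    exact ((Matrix.isUnit_iff_isUnit_det _).1 hr).ne_zero
  have hunit : IsUnit (A.submatrix r id).det := by
    obtain ⟨s, hs⟩ := (Matrix.isTotallyUnimodular_iff_fintype A).1 hA E r id
    rw [← hs] at hdet ⊢
    cases s <;> simp at hdet ⊢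
  obtain ⟨d, hd⟩ := Submodule.mem_span_range_iff_exists_fun ℤ |>.1 hx
  have hdx : A.mulVec d = n • x := by
    rw [← hd]
    ext i
    simp [Matrix.mulVec, dotProduct, mul_comm]
  set N := A.submatrix r id with hN
  have h1 : N.mulVec d = n • (x ∘ r) := by
    ext i
    exact congrFun hdx (r i)
  have h2 : d = n • N⁻¹.mulVec (x ∘ r) := by
    rw [← Matrix.mulVec_smul, ← h1, Matrix.mulVec_mulVec, Matrix.nonsing_inv_mul _ hunit,
      Matrix.one_mulVec]
  rw [h2, Matrix.mulVec_smul] at hdx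
  have h3 := smul_right_injective _ hn hdx
  rw [← h3, Submodule.mem_span_range_iff_exists_fun]
  refine ⟨N⁻¹.mulVec (x ∘ r), ?_⟩
  ext i
  simp [Matrix.mulVec, dotProduct, mul_comm]

theorem Matrix.IsTotallyUnimodular.isSaturatedFamily {ι E : Type*} [Finite ι] [Finite E]
    {A : Matrix ι E ℤ} (hA : A.IsTotallyUnimodular) : IsSaturatedFamily A.col := by
  have key (B : Set E) (hB : LinearIndepOn ℤ A.col B) (n : ℤ) (x : ι → ℤ) (hn : n ≠ 0)
      (hx : n • x ∈ Submodule.span ℤ (A.col '' B)) : x ∈ Submodule.span ℤ (A.col '' B) := by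
    rw [Set.image_eq_range] at hx ⊢
    exact (hA.submatrix id ((↑) : B → E)).mem_span_of_smul_mem hB hn hx
  intro S n x hn hx
  -- Every column in `S` has a nonzero multiple in the span of a maximal independent `B`, hence lies
  -- in that span by `key`.
  obtain ⟨B, hB, hmax⟩ := exists_maximal_linearIndepOn ℤ (fun e : S => A.col e)
  have hB' : LinearIndepOn ℤ A.col ((↑) '' B : Set E) :=
    (linearIndependent_equiv' (Equiv.Set.image _ B Subtype.val_injective) rfl).1 hB
  have hspan : Submodule.span ℤ (A.col '' S) ≤ Submodule.span ℤ (A.col '' ((↑) '' B : Set E)) := by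
    rw [Submodule.span_le]
    rintro _ ⟨e, he, rfl⟩
    by_cases heB : ⟨e, he⟩ ∈ B
    · exact Submodule.subset_span ⟨e, ⟨_, heB, rfl⟩, rfl⟩
    · obtain ⟨a, ha, h⟩ := hmax _ heB
      refine key _ hB' a _ ha ?_
      rwa [Set.image_image]
  refine Submodule.span_mono (Set.image_mono ?_) (key _ hB' n x hn (hspan hx))
  rintro _ ⟨e, -, rfl⟩
  exact e.2

/-! ### Rounding real coefficients to integers -/

theorem IsSaturatedFamily.eq_zero_of_tmul_eq_zero {E L : Type*} [AddCommGroup L] {v : E → L}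
    (hv : IsSaturatedFamily v) {a : ℝ} {x : L} (h : a ⊗ₜ[ℤ] x = 0) : a = 0 ∨ x = 0 := by
  by_contra! hcon
  have h1 : LinearIndependent ℤ (fun _ : Unit => a) := 
    LinearIndependent.of_subsingleton () hcon.1
  have h2 : LinearIndependent ℤ (fun _ : Unit => x) := by
    rw [Fintype.linearIndependent_iff]
    intro g hg i
    by_contra hi
    exact hcon.2 (hv.eq_zero_of_smul hi (by simpa using hg))
  exact (h1.tmul_of_flat_left h2).ne_zero ((), ()) h

/-- The fractional parts represent some `y` that dies modulo the span of the fractional columns, so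
`y` is an integer combination of them. Independence persists over `ℝ` by flatness, so each
fractional part is an integer, hence zero. -/
theorem IsSaturatedFamily.fract_eq_zero_of_linearIndepOn {E L : Type*} [Fintype E]
    [AddCommGroup L] {v : E → L} (hv : IsSaturatedFamily v) {c : E → ℝ} {x : L}
    (h : ∑ e, c e ⊗ₜ[ℤ] v e = 1 ⊗ₜ[ℤ] x)
    (hli : LinearIndepOn ℤ v {e | Int.fract (c e) ≠ 0}) (e : E) : Int.fract (c e) = 0 := by
  classical
  set F : Set E := {e | Int.fract (c e) ≠ 0} with hF
  set y : L := x - ∑ e, ⌊c e⌋ • v e with hy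
  have hfr : ∑ e, Int.fract (c e) ⊗ₜ[ℤ] v e = 1 ⊗ₜ[ℤ] y := by
    rw [hy, TensorProduct.tmul_sub, ← h, TensorProduct.tmul_sum, ← Finset.sum_sub_distrib]
    refine Finset.sum_congr rfl fun e _ => ?_
    rw [← TensorProduct.smul_tmul, ← TensorProduct.sub_tmul, Int.fract]
    simp
  have hyF : y ∈ Submodule.span ℤ (v '' F) := by
    have h1 := congrArg ((Submodule.span ℤ (v '' F)).mkQ.lTensor ℝ) hfr
    rw [map_sum, LinearMap.lTensor_tmul, Finset.sum_eq_zero] at h1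
    · exact (Submodule.Quotient.mk_eq_zero _).1
        (((hv.quotient F).eq_zero_of_tmul_eq_zero h1.symm).resolve_left one_ne_zero)
    · intro e _
      rw [LinearMap.lTensor_tmul]
      by_cases he : e ∈ F
      · have : (Submodule.span ℤ (v '' F)).mkQ (v e) = 0 :=
          (Submodule.Quotient.mk_eq_zero _).2 (Submodule.subset_span ⟨e, he, rfl⟩)
        rw [this, TensorProduct.tmul_zero]
      · rw [not_not.1 he, TensorProduct.zero_tmul]
  obtain ⟨k, hk, hky⟩ := (Finsupp.mem_span_image_iff_linearCombination ℤ).1 hyF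
  rw [Finsupp.linearCombination_apply, Finsupp.sum_fintype _ _ (by simp)] at hky
  have hzero : ∑ e, (Int.fract (c e) - k e) • ((1 : ℝ) ⊗ₜ[ℤ] v e) = 0 := by
    have (e : E) : (Int.fract (c e) - k e) • ((1 : ℝ) ⊗ₜ[ℤ] v e) =
        Int.fract (c e) ⊗ₜ[ℤ] v e - (1 : ℝ) ⊗ₜ[ℤ] (k e • v e) := by
      rw [sub_smul, TensorProduct.smul_tmul', TensorProduct.smul_tmul', ← TensorProduct.smul_tmul]
      simp
    simp only [this]
    rw [Finset.sum_sub_distrib, hfr, ← TensorProduct.tmul_sum, hky, sub_self]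
  have hsupp (e : E) (he : e ∉ F) : Int.fract (c e) - k e = 0 := by
    have h1 : Int.fract (c e) = 0 := not_not.1 he
    have h2 : k e = 0 := by
      by_contra h2
      exact he (hk (by simpa using h2))
    simp [h1, h2]
  have hall (e : E) : Int.fract (c e) - k e = 0 := by
    by_cases he : e ∈ F
    · have h1 := Fintype.linearIndependent_iff.1 (Module.Flat.linearIndependent_one_tmul (S := ℝ) hli)
        (fun e : F => Int.fract (c e) - k e) ?_ ⟨e, he⟩
      · exact h1
      · rw [← Finset.sum_subtype (Finset.univ.filter (· ∈ F)) (by simp)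
          (fun e => (Int.fract (c e) - k e) • ((1 : ℝ) ⊗ₜ[ℤ] v e)), Finset.sum_filter_of_ne, hzero]
        intro e _ hne
        by_contra he
        exact hne (by rw [hsupp e he, zero_smul])
    · exact hsupp e he
  have := congrArg Int.fract (sub_eq_zero.1 (hall e))
  rwa [Int.fract_fract, Int.fract_intCast] at this

/-- If `c` has a nonintegral coordinate in the support of `k`, a multiple of `k` can be added to `c`
so that some nonintegral coordinate becomes integral, without crossing any integer. -/
theorem exists_add_smul_fract_eq_zero {E : Type*} [Fintype E] (c : E → ℝ) (k : E → ℤ)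
    (hk : ∀ e, k e ≠ 0 → Int.fract (c e) ≠ 0) (hk0 : k ≠ 0) :
    ∃ t : ℝ, (∀ e, (⌊c e⌋ : ℝ) ≤ c e + t * k e ∧ c e + t * k e ≤ ⌈c e⌉) ∧
      ∃ e, Int.fract (c e) ≠ 0 ∧ Int.fract (c e + t * k e) = 0 := by
  classical
  obtain ⟨e0, he0⟩ := Function.ne_iff.1 hk0
  -- `g e` is the time at which coordinate `e`, moving with velocity `k e`, first reaches an
  -- integer; the least such time is used.
  set g : E → ℝ := fun e => if 0 < k e then (⌈c e⌉ - c e) / k e else (⌊c e⌋ - c e) / k e with hg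
  obtain ⟨e1, he1, hmin⟩ := (Finset.univ.filter fun e => k e ≠ 0).exists_min_image g
    ⟨e0, by simpa using he0⟩
  have hk1 : k e1 ≠ 0 := by simpa using he1
  have hk1' : (k e1 : ℝ) ≠ 0 := by exact_mod_cast hk1
  have hpos : 0 ≤ g e1 := by
    simp only [hg]
    split_ifs with h
    · exact div_nonneg (sub_nonneg.2 (Int.le_ceil _)) (by exact_mod_cast h.le)
    · exact div_nonneg_of_nonpos (sub_nonpos.2 (Int.floor_le _)) (by exact_mod_cast not_lt.1 h)
  refine ⟨g e1, fun e => ?_, e1, hk e1 hk1, ?_⟩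
  · have hfl := Int.floor_le (c e)
    have hce := Int.le_ceil (c e)
    rcases lt_trichotomy (k e) 0 with h | h | h
    · have h' : (k e : ℝ) < 0 := by exact_mod_cast h
      have h1 := hmin e (by simpa using h.ne)
      simp only [hg, not_lt.2 h.le, if_false] at h1
      rw [le_div_iff_of_neg h'] at h1
      have h2 := mul_nonpos_of_nonneg_of_nonpos hpos h'.le
      simp only [hg] at h2
      constructor <;> simp only [hg] <;> linarith
    · simp [h, hfl, hce]
    · have h' : (0 : ℝ) < k e := by exact_mod_cast h
      have h1 := hmin e (by simpa using h.ne')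
      have h2 := mul_nonneg hpos h'.le
      simp only [hg] at h2
      simp only [hg, h, if_true] at h1
      rw [le_div_iff₀ h'] at h1
      constructor <;> simp only [hg] <;> linarith
  · simp only [hg]
    split_ifs <;> rw [div_mul_cancel₀ _ hk1', add_sub_cancel, Int.fract_intCast]

/-- While the columns with fractional coefficients are dependent, moving along an integer relation
among them makes one more coefficient integral. Once they are independent, all coefficients are
integers. -/
theorem IsSaturatedFamily.exists_int_sum_eq {E L : Type*} [Fintype E] [AddCommGroup L] {v : E → L}
    (hv : IsSaturatedFamily v) {x : L} {l u : E → ℤ} {c : E → ℝ}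
    (h : ∑ e, c e ⊗ₜ[ℤ] v e = 1 ⊗ₜ[ℤ] x) (hc : ∀ e, (l e : ℝ) ≤ c e ∧ c e ≤ u e) :
    ∃ d : E → ℤ, (∀ e, l e ≤ d e ∧ d e ≤ u e) ∧ ∑ e, d e • v e = x := by
  induction hn : {e | Int.fract (c e) ≠ 0}.ncard using Nat.strong_induction_on generalizing c with
  | _ n ih =>
  by_cases hli : LinearIndepOn ℤ v {e | Int.fract (c e) ≠ 0}
  · have hfr := hv.fract_eq_zero_of_linearIndepOn h hli
    have hfl (e : E) : (⌊c e⌋ : ℝ) = c e := by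
      have := Int.floor_add_fract (c e)
      rwa [hfr, add_zero] at this
    refine ⟨fun e => ⌊c e⌋, fun e => ⟨?_, ?_⟩, ?_⟩
    · exact Int.le_floor.2 (hc e).1
    · exact_mod_cast (hfl e).le.trans (hc e).2
    · have h1 : (1 : ℝ) ⊗ₜ[ℤ] (∑ e, ⌊c e⌋ • v e - x) = 0 := by
        rw [TensorProduct.tmul_sub, ← h, TensorProduct.tmul_sum, sub_eq_zero]
        refine Finset.sum_congr rfl fun e _ => ?_
        rw [← TensorProduct.smul_tmul]
        simp [hfl]
      exact sub_eq_zero.1 ((hv.eq_zero_of_tmul_eq_zero h1).resolve_left one_ne_zero)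
  · rw [linearIndepOn_iff] at hli
    push Not at hli
    obtain ⟨k, hk, hkv, hk0⟩ := hli
    rw [Finsupp.linearCombination_apply, Finsupp.sum_fintype _ _ (by simp)] at hkv
    have hkF (e : E) (he : k e ≠ 0) : Int.fract (c e) ≠ 0 := hk (by simpa using he)
    obtain ⟨t, ht, e1, he1, he1'⟩ := exists_add_smul_fract_eq_zero c k hkF
      (fun h0 => hk0 (DFunLike.coe_injective h0))
    refine ih _ ?_ (c := fun e => c e + t * k e) ?_ (fun e => ⟨?_, ?_⟩) rfl
    · rw [← hn]
      refine Set.ncard_lt_ncard ⟨fun e he => ?_, fun hsub => hsub he1 he1'⟩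
      by_cases hke : k e = 0
      · simpa [hke] using he
      · exact hkF e hke
    · have (e : E) : (c e + t * k e) ⊗ₜ[ℤ] v e = c e ⊗ₜ[ℤ] v e + t ⊗ₜ[ℤ] (k e • v e) := by
        rw [TensorProduct.add_tmul, ← TensorProduct.smul_tmul]
        simp [mul_comm]
      simp only [this]
      rw [Finset.sum_add_distrib, ← TensorProduct.tmul_sum, hkv, TensorProduct.tmul_zero, add_zero,
        h]
    · exact le_trans (by exact_mod_cast Int.le_floor.2 (hc e).1) (ht e).1
    · exact (ht e).2.trans (by exact_mod_cast Int.ceil_le.2 (hc e).2)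

/-- Dividing `d` by `-d e₀` makes the `e₀` coordinate `-1` and shrinks the others towards zero; the
result is then rounded, with both bounds at `e₀` equal to `-1`. -/
theorem IsSaturatedFamily.exists_conformal_relation {E L : Type*} [Fintype E] [AddCommGroup L]
    {v : E → L} (hv : IsSaturatedFamily v) {d : E → ℤ} (hd : ∑ e, d e • v e = 0) {e₀ : E}
    (he₀ : d e₀ < 0) :
    ∃ w : E → ℤ, ∑ e, w e • v e = 0 ∧ w e₀ = -1 ∧ ∀ e, min 0 (d e) ≤ w e ∧ w e ≤ max 0 (d e) := by
  classical
  have hneg : (0 : ℝ) < -d e₀ := by exact_mod_cast neg_pos.2 he₀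
  have hone : (1 : ℝ) ≤ -d e₀ := by exact_mod_cast Int.add_one_le_iff.2 (neg_pos.2 he₀)
  have hsum : ∑ e, ((-d e₀ : ℝ)⁻¹ * d e) ⊗ₜ[ℤ] v e = 1 ⊗ₜ[ℤ] (0 : L) := by
    have (e : E) : ((-d e₀ : ℝ)⁻¹ * d e) ⊗ₜ[ℤ] v e = (-d e₀ : ℝ)⁻¹ ⊗ₜ[ℤ] (d e • v e) := by
      rw [← TensorProduct.smul_tmul]
      simp [mul_comm]
    simp only [this]
    rw [← TensorProduct.tmul_sum, hd, TensorProduct.tmul_zero, TensorProduct.tmul_zero]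
  have hbd (e : E) : (((if e = e₀ then -1 else min 0 (d e) : ℤ)) : ℝ) ≤ (-d e₀ : ℝ)⁻¹ * d e ∧
      (-d e₀ : ℝ)⁻¹ * d e ≤ ((if e = e₀ then -1 else max 0 (d e) : ℤ) : ℝ) := by
    by_cases h : e = e₀
    · subst h
      have : (-d e : ℝ)⁻¹ * d e = -1 := by
        rw [inv_neg, neg_mul, inv_mul_cancel₀ (by linarith)]
      rw [this]
      simp
    · simp only [h, if_false]
      push_cast
      have h1 : (-d e₀ : ℝ)⁻¹ ≤ 1 := inv_le_one_of_one_le₀ hone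
      have h0 : 0 ≤ (-d e₀ : ℝ)⁻¹ := (inv_pos.2 hneg).le
      rcases le_total (d e : ℝ) 0 with h2 | h2
      · rw [min_eq_right h2, max_eq_left h2]
        exact ⟨by nlinarith, mul_nonpos_of_nonneg_of_nonpos h0 h2⟩
      · rw [min_eq_left h2, max_eq_right h2]
        exact ⟨mul_nonneg h0 h2, mul_le_of_le_one_left h2 h1⟩
  obtain ⟨w, hw, hw0⟩ := hv.exists_int_sum_eq hsum hbd
  have hwe : w e₀ = -1 := by
    have := hw e₀
    simp only [if_true] at this
    omega
  refine ⟨w, hw0, hwe, fun e => ?_⟩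
  have := hw e
  by_cases h : e = e₀
  · subst h
    omega
  · simpa [h] using this

/-! ### Deletion and contraction for box sums and independent sets -/

/-- The sums `∑ e, c e • v e` with integer coefficients `0 ≤ c e ≤ m e`. -/
def boxSums {E L : Type*} [Fintype E] [AddCommGroup L] (v : E → L) (m : E → ℕ) : Set L :=
  {x | ∃ c : E → ℤ, (∀ e, 0 ≤ c e ∧ c e ≤ m e) ∧ ∑ e, c e • v e = x}

open Classical in
/-- The generating function of the linearly independent subfamilies of `v`, with weights `m`. -/
noncomputable def indepSum {E L : Type*} [Fintype E] [AddCommGroup L] (v : E → L) (m : E → ℕ) : ℕ :=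
  ∑ S : Finset E, if LinearIndepOn ℤ v (S : Set E) then ∏ e ∈ S, m e else 0

section

variable {E : Type*} [Fintype E]

theorem boxSums_finite {L : Type*} [AddCommGroup L] (v : E → L) (m : E → ℕ) :
    (boxSums v m).Finite :=
  (Set.Finite.pi' fun e => Set.finite_Icc (0 : ℤ) (m e)).image fun c : E → ℤ => ∑ e, c e • v e

theorem boxSums_zero {L : Type*} [AddCommGroup L] (v : E → L) : boxSums v 0 = {0} := by
  ext x
  refine ⟨?_, fun hx => ⟨0, by simp, by simp [Set.mem_singleton_iff.1 hx]⟩⟩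
  rintro ⟨c, hc, rfl⟩
  refine Finset.sum_eq_zero fun e _ => ?_
  have := hc e
  simp only [Pi.zero_apply, Nat.cast_zero] at this
  rw [le_antisymm this.2 this.1, zero_smul]

theorem boxSums_mono {L : Type*} [AddCommGroup L] (v : E → L) {m m' : E → ℕ} (h : m ≤ m') :
    boxSums v m ⊆ boxSums v m' := by
  rintro x ⟨c, hc, rfl⟩
  exact ⟨c, fun e => ⟨(hc e).1, (hc e).2.trans (by exact_mod_cast h e)⟩, rfl⟩

theorem indepSum_zero {L : Type*} [AddCommGroup L] (v : E → L) : indepSum v 0 = 1 := by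
  classical
  rw [indepSum, Finset.sum_eq_single ∅]
  · simp
  · intro S _ hS
    obtain ⟨e, he⟩ := Finset.nonempty_iff_ne_empty.2 hS
    rw [Finset.prod_eq_zero he rfl, ite_self]
  · simp

variable [DecidableEq E]

theorem sum_update_smul {L : Type*} [AddCommGroup L] (v : E → L) (c : E → ℤ) (e : E) (k : ℤ) :
    ∑ f, Function.update c e k f • v f = ∑ f, c f • v f + (k - c e) • v e := by
  have : Function.update c e k = c + Pi.single e (k - c e) := by
    ext f
    by_cases h : f = e
    · subst h; simp
    · simp [h]
  simp [this, add_smul, Finset.sum_add_distrib, Pi.single_apply]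

theorem boxSums_update_of_eq_zero {L : Type*} [AddCommGroup L] {v : E → L} {e : E} (he : v e = 0)
    (m : E → ℕ) (k : ℕ) : boxSums v (Function.update m e k) = boxSums v m := by
  have key (m m' : E → ℕ) (h : ∀ f ≠ e, m f = m' f) : boxSums v m ⊆ boxSums v m' := by
    rintro x ⟨c, hc, rfl⟩
    refine ⟨Function.update c e 0, fun f => ?_, by simp [sum_update_smul, he]⟩
    by_cases hf : f = e
    · subst hf; simp
    · simpa [hf, ← h f hf] using hc f
  exact (key _ _ fun f hf => by simp [hf]).antisymm (key _ _ fun f hf => by simp [hf])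

theorem indepSum_update_of_eq_zero {L : Type*} [AddCommGroup L] {v : E → L} {e : E} (he : v e = 0)
    (m : E → ℕ) (k : ℕ) : indepSum v (Function.update m e k) = indepSum v m := by
  classical
  refine Finset.sum_congr rfl fun S _ => ?_
  split_ifs with hS
  · have heS : e ∉ S := fun h => hS.ne_zero (i := e) h he
    exact Finset.prod_update_of_notMem heS _ _
  · rfl

namespace IsSaturatedFamily

variable {L : Type*} [AddCommGroup L] {v : E → L}

/-- Two points of the box sums on a line in direction `v e`: the lower one remains when the range of
the coefficient of `v e` is shortened by one. -/
theorem mem_boxSums_update_of_add_smul_mem (hv : IsSaturatedFamily v) {m : E → ℕ} {e : E}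
    (hm : 0 < m e) {x : L} {k : ℤ} (hk : 0 < k) (hx : x ∈ boxSums v m)
    (hxk : x + k • v e ∈ boxSums v m) : x ∈ boxSums v (Function.update m e (m e - 1)) := by
  obtain ⟨c, hc, rfl⟩ := hx
  obtain ⟨c', hc', hcc'⟩ := hxk
  by_cases hce : c e < m e
  · refine ⟨c, fun f => ?_, rfl⟩
    by_cases hf : f = e
    · subst hf
      have := hc f
      rw [Function.update_self]
      omega
    · simpa [hf] using hc f
  have hce' : c e = m e := le_antisymm (hc e).2 (not_lt.1 hce)
  -- With `c e` maximal, this relation is negative at `e`. A conformal relation `w` inside it lowers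
  -- `c e` by exactly one and keeps the other coordinates between those of `c` and `c'`.
  have hd : ∑ f, (c' f - c f - Pi.single (M := fun _ => ℤ) e k f) • v f = 0 := by
    simp only [sub_smul, Finset.sum_sub_distrib, hcc']
    simp [Pi.single_apply]
  have hneg : c' e - c e - Pi.single (M := fun _ => ℤ) e k e < 0 := by
    have := hc' e
    simp
    omega
  obtain ⟨w, hw, hwe, hwb⟩ := hv.exists_conformal_relation hd hneg
  refine ⟨c + w, fun f => ?_, ?_⟩
  · have h1 := hc f
    have h2 := hc' f
    have h3 := hwb f
    by_cases hf : f = e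
    · subst hf
      rw [Function.update_self, Pi.add_apply, hwe, hce']
      omega
    · rw [Pi.single_eq_of_ne hf] at h3
      rw [Function.update_of_ne hf, Pi.add_apply]
      omega
  · simp [add_smul, Finset.sum_add_distrib, hw]

theorem bijOn_mkQ_boxSums_diff (hv : IsSaturatedFamily v) {m : E → ℕ} {e : E} (hm : 0 < m e)
    (he : v e ≠ 0) :
    Set.BijOn (Submodule.span ℤ (v '' {e})).mkQ
      (boxSums v m \ boxSums v (Function.update m e (m e - 1)))
      (boxSums ((Submodule.span ℤ (v '' {e})).mkQ ∘ v) (Function.update m e 0)) := by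
  set π := (Submodule.span ℤ (v '' {e})).mkQ with hπ
  have hmem (x y : L) : π x = π y ↔ ∃ k : ℤ, y = x + k • v e := by
    rw [hπ, Submodule.mkQ_apply, Submodule.mkQ_apply, eq_comm, Submodule.Quotient.eq,
      Set.image_singleton, Submodule.mem_span_singleton]
    exact exists_congr fun k => ⟨fun h => by rw [h]; abel, fun h => by rw [h]; abel⟩
  have hπe : π (v e) = 0 := by
    rw [← map_zero π, hmem]
    exact ⟨-1, by simp⟩
  refine ⟨?_, ?_, ?_⟩
  · rintro x ⟨⟨c, hc, rfl⟩, -⟩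
    refine ⟨Function.update c e 0, fun f => ?_, ?_⟩
    · by_cases hf : f = e
      · subst hf; simp
      · simpa [hf] using hc f
    · rw [sum_update_smul]
      simp [hπe]
  · intro x hx y hy hxy
    obtain ⟨k, hk⟩ := (hmem x y).1 hxy
    rcases lt_trichotomy k 0 with h | h | h
    · have hxy' : x = y + (-k) • v e := by rw [hk, neg_smul, add_neg_cancel_right]
      exact absurd (hv.mem_boxSums_update_of_add_smul_mem hm (neg_pos.2 h) hy.1 (hxy' ▸ hx.1)) hy.2
    · rw [hk, h, zero_smul, add_zero]
    · exact absurd (hv.mem_boxSums_update_of_add_smul_mem hm h hx.1 (hk ▸ hy.1)) hx.2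
  · rintro _ ⟨c, hc, rfl⟩
    have hce : c e = 0 := by
      have := hc e
      simp only [Function.update_self] at this
      omega
    set x := ∑ f, c f • v f with hx
    have hxm : x ∈ boxSums v m := by
      refine boxSums_mono v (fun f => ?_) ⟨c, hc, rfl⟩
      by_cases hf : f = e
      · subst hf; simp
      · simp [hf]
    have hinj : Function.Injective fun k : ℤ => x + k • v e := by
      intro k l hkl
      by_contra hne
      refine he (hv.eq_zero_of_smul (sub_ne_zero.2 hne) ?_)
      rw [sub_smul, sub_eq_zero]
      exact add_left_cancel hkl
    -- The top point of the fibre survives the deletion: if it had a representation with coefficient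
    -- at most `m e - 1` at `e`, raising that coefficient would give a higher point.
    obtain ⟨k, hk, hmax⟩ := Set.exists_max_image {k : ℤ | x + k • v e ∈ boxSums v m} id
      ((boxSums_finite v m).preimage hinj.injOn) ⟨0, by simpa using hxm⟩
    refine ⟨x + k • v e, ⟨hk, ?_⟩, ?_⟩
    · rintro ⟨b, hb, hbx⟩
      have h1 : k + 1 ≤ k := hmax (k + 1) ⟨Function.update b e (b e + 1), fun f => ?_, ?_⟩
      · omega
      · by_cases hf : f = e
        · subst hf
          have := hb f
          rw [Function.update_self] at this ⊢
          omega
        · simpa [hf] using hb f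
      · rw [sum_update_smul, hbx]
        simp [add_smul, add_assoc]
    · simp [hπe, hx, map_sum]

theorem ncard_boxSums_eq_add (hv : IsSaturatedFamily v) {m : E → ℕ} {e : E} (hm : 0 < m e)
    (he : v e ≠ 0) :
    (boxSums v m).ncard = (boxSums v (Function.update m e (m e - 1))).ncard +
      (boxSums ((Submodule.span ℤ (v '' {e})).mkQ ∘ v) (Function.update m e 0)).ncard := by
  have h := hv.bijOn_mkQ_boxSums_diff hm he
  have hsub : boxSums v (Function.update m e (m e - 1)) ⊆ boxSums v m := by
    refine boxSums_mono v fun f => ?_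
    by_cases hf : f = e
    · subst hf; simp
    · simp [hf]
  rw [← h.image_eq, h.injOn.ncard_image, add_comm,
    Set.ncard_sdiff_add_ncard_of_subset hsub (boxSums_finite v m)]

/-- For `e ∉ T`, `insert e T` is independent iff `T` is independent in the quotient. Writing `m e =
(m e - 1) + 1` splits its weight between the two sums; weight zero at `e` removes the other sets
from the quotient sum. -/
theorem indepSum_eq_add (hv : IsSaturatedFamily v) {m : E → ℕ} {e : E} (hm : 0 < m e)
    (he : v e ≠ 0) :
    indepSum v m = indepSum v (Function.update m e (m e - 1)) +
      indepSum ((Submodule.span ℤ (v '' {e})).mkQ ∘ v) (Function.update m e 0) := by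
  classical
  have hli : LinearIndepOn ℤ v {e} := by
    rw [LinearIndepOn, Fintype.linearIndependent_iff]
    intro g hg i
    by_contra hi
    refine he (hv.eq_zero_of_smul hi ?_)
    have : i = ⟨e, rfl⟩ := Subsingleton.elim _ _
    subst this
    simpa using hg
  have huniv : (Finset.univ : Finset (Finset E)) = (insert e (Finset.univ.erase e)).powerset := by
    simp
  simp only [indepSum]
  rw [huniv]
  simp only [Finset.sum_powerset_insert (Finset.notMem_erase e Finset.univ)]
  simp only [← Finset.sum_add_distrib]
  refine Finset.sum_congr rfl fun T hT => ?_
  have heT : e ∉ T := fun h => Finset.notMem_erase e _ (Finset.mem_powerset.1 hT h)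
  have hq : LinearIndepOn ℤ ((Submodule.span ℤ (v '' {e})).mkQ ∘ v) (T : Set E) ↔
      LinearIndepOn ℤ v (insert e T : Finset E) := by
    rw [hli.quotient_iff_union (by simpa using heT), Set.singleton_union, Finset.coe_insert]
  simp only [hq, Finset.prod_insert heT, Finset.prod_update_of_notMem heT, Function.update_self]
  obtain ⟨n, hn⟩ := Nat.exists_eq_add_of_lt hm
  rw [hn]
  split_ifs <;> simp <;> ring

end IsSaturatedFamily

end

/-- The number of box sums of a saturated family counts its independent subfamilies. -/
theorem IsSaturatedFamily.ncard_boxSums {E L : Type*} [Fintype E] [AddCommGroup L] {v : E → L}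
    (hv : IsSaturatedFamily v) (m : E → ℕ) : (boxSums v m).ncard = indepSum v m := by
  classical
  -- The group `L` must vary, since contraction replaces it by a quotient.
  induction hn : ∑ e, m e using Nat.strong_induction_on generalizing L m with
  | _ n ih =>
  by_cases h0 : m = 0
  · rw [h0, boxSums_zero, indepSum_zero, Set.ncard_singleton]
  obtain ⟨e, he⟩ := Function.ne_iff.1 h0
  have hpos : 0 < m e := Nat.pos_of_ne_zero he
  have hlt (k : ℕ) (hk : k < m e) : ∑ f, Function.update m e k f < n := by
    rw [← hn]
    refine Finset.sum_lt_sum (fun f _ => ?_) ⟨e, Finset.mem_univ _, by simpa using hk⟩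
    by_cases hf : f = e
    · subst hf; simpa using hk.le
    · simp [hf]
  have h1 := ih _ (hlt (m e - 1) (by omega)) hv (Function.update m e (m e - 1)) rfl
  by_cases hve : v e = 0
  · rwa [boxSums_update_of_eq_zero hve, indepSum_update_of_eq_zero hve] at h1
  · rw [hv.ncard_boxSums_eq_add hpos hve, hv.indepSum_eq_add hpos hve, h1,
      ih _ (hlt 0 hpos) (hv.quotient {e}) _ rfl]

/-! ### The Tutte polynomial on the line `y = 1` -/

theorem Matroid.natRk_eq_card_iff_indep {α : Type*} {M : Matroid α} (S : Finset α) :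
    M.natRk (S : Set α) = S.card ↔ M.Indep (S : Set α) := by
  obtain ⟨I, hI⟩ := M.exists_isBasis' (S : Set α)
  have hfin : I.Finite := S.finite_toSet.subset hI.subset
  rw [Matroid.natRk, hI.eRk_eq_encard]
  change I.ncard = _ ↔ _
  rw [← Set.ncard_coe_finset]
  refine ⟨fun h => ?_, fun h => ?_⟩
  · rw [← Set.eq_of_subset_of_ncard_le hI.subset h.ge S.finite_toSet]
    exact hI.indep
  · exact congrArg ENat.toNat (hI.eRk_eq_encard.symm.trans h.eRk_eq_encard)

theorem Matroid.natRk_le_card {α : Type*} (M : Matroid α) (S : Finset α) :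
    M.natRk (S : Set α) ≤ S.card := by
  have h := M.eRk_le_encard (S : Set α)
  rw [Set.encard_coe_eq_coe_finsetCard] at h
  exact ENat.toNat_le_of_le_natCast h

theorem Matroid.natRk_mono {α : Type*} (M : Matroid α) [M.Finite] {S T : Set α} (h : S ⊆ T) :
    M.natRk S ≤ M.natRk T :=
  ENat.toNat_le_toNat (M.eRk_mono h) (Matroid.eRk_ne_top_iff.2 (Matroid.RankFinite.isRkFinite T))

open Classical in
/-- The Tutte polynomial on the line `y = 1` enumerates independent sets by size. -/
theorem Matroid.pow_natRk_mul_aeval_tuttePolynomial {α : Type*} [Fintype α] (M : Matroid α)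
    [M.Finite] (hM : M.E = Set.univ) {q : ℚ} (hq : q ≠ 0) :
    q ^ M.natRk M.E * MvPolynomial.aeval ![1 + 1 / q, 1] M.tuttePolynomial =
      ∑ S : Finset α, if M.Indep (S : Set α) then q ^ S.card else 0 := by
  have huniv : M.ground_finite.toFinset.powerset = Finset.univ := by
    ext S
    simp [hM]
  rw [Matroid.tuttePolynomial, huniv, map_sum, Finset.mul_sum]
  refine Finset.sum_congr rfl fun S _ => ?_
  simp only [map_mul, map_pow, map_sub, MvPolynomial.aeval_X, map_one, Matrix.cons_val_zero,
    Matrix.cons_val_one, sub_self, add_sub_cancel_left]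
  have hle := M.natRk_le_card S
  have hmono : M.natRk (S : Set α) ≤ M.natRk M.E := M.natRk_mono (by simp [hM])
  split_ifs with hS
  · rw [← M.natRk_eq_card_iff_indep] at hS
    rw [hS, Nat.sub_self, pow_zero, mul_one, one_div, inv_pow, ← div_eq_mul_inv,
      div_eq_iff (pow_ne_zero _ hq), ← pow_add, Nat.add_sub_cancel' (hS ▸ hmono)]
  -- A dependent set has positive nullity, so its factor is a positive power of `y - 1 = 0`.
  · rw [← M.natRk_eq_card_iff_indep] at hS
    rw [zero_pow (by omega), mul_zero, mul_zero]

/-! ### Lattice points of the dilated zonotope -/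

theorem Matrix.IsTotallyUnimodular.latticePoints_smul_zonotope {ι E : Type*} [Finite ι] [Fintype E]
    {A : Matrix ι E ℤ} (hA : A.IsTotallyUnimodular) {q : ℕ} (hq : 0 < q) :
    latticePoints ((q : ℝ) • zonotope A) = boxSums A.col (fun _ => q) := by
  classical
  have := Fintype.ofFinite ι
  have hq' : (0 : ℝ) < q := by exact_mod_cast hq
  ext z
  constructor
  · rintro ⟨_, ⟨c, hc, rfl⟩, hz⟩
    obtain ⟨d, hd, hdz⟩ := hA.isSaturatedFamily.exists_int_sum_eq (x := z)
      (c := fun e => q * c e) (l := 0) (u := fun _ => q)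
      (by
        -- The identification of `ℝ ⊗ ℤ^ι` with `ℝ^ι` turns the tensor identity into the coordinate
        -- equations `hz`.
        apply (TensorProduct.piScalarRight ℤ ℤ ℝ ι).injective
        rw [map_sum]
        ext i
        have := congrFun hz i
        simp only [Pi.smul_apply, Finset.sum_apply, smul_eq_mul, Finset.mul_sum] at this
        simp only [Finset.sum_apply, TensorProduct.piScalarRight_apply,
          TensorProduct.piScalarRightHom_tmul, zsmul_eq_mul, mul_one]
        rw [← this]
        refine Finset.sum_congr rfl fun e _ => ?_
        simp only [Matrix.col_apply, Matrix.map_apply]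
        ring)
      (fun e => ⟨by simpa using mul_nonneg hq'.le (hc e).1,
        by simpa using mul_le_of_le_one_right hq'.le (hc e).2⟩)
    exact ⟨d, hd, hdz⟩
  · rintro ⟨d, hd, rfl⟩
    refine ⟨_, ⟨fun e => d e / q, fun e => ⟨?_, ?_⟩, rfl⟩, ?_⟩
    · exact div_nonneg (by exact_mod_cast (hd e).1) hq'.le
    · exact (div_le_one hq').2 (by exact_mod_cast (hd e).2)
    · ext i
      simp only [Pi.smul_apply, Finset.sum_apply, smul_eq_mul, Finset.mul_sum, Int.cast_sum,
        Matrix.col_apply, Matrix.map_apply, Int.cast_mul]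
      refine Finset.sum_congr rfl fun e _ => ?_
      field_simp

theorem regularMatroid_indep_iff {ι E : Type*} [Finite ι] [Finite E] (A : Matrix ι E ℤ)
    (S : Set E) : (regularMatroid A).Indep S ↔ LinearIndepOn ℤ A.col S :=
  linearIndependent_map_intCast_col_iff (A.submatrix id ((↑) : S → E))

theorem mainTheorem11 {ι E : Type*} [Fintype ι] [Fintype E] (A : Matrix ι E ℤ)
    (hA : A.IsTotallyUnimodular) (q : ℕ) (hq : 0 < q) :
    (latticePoints ((q : ℝ) • zonotope A)).Finite ∧
      ((latticePoints ((q : ℝ) • zonotope A)).ncard : ℚ) =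
        (q : ℚ) ^ (regularMatroid A).natRk (regularMatroid A).E *
          MvPolynomial.aeval ![1 + 1 / (q : ℚ), 1] (regularMatroid A).tuttePolynomial := by
  rw [hA.latticePoints_smul_zonotope hq]
  refine ⟨boxSums_finite _ _, ?_⟩
  rw [hA.isSaturatedFamily.ncard_boxSums,
    Matroid.pow_natRk_mul_aeval_tuttePolynomial _ rfl (by exact_mod_cast hq.ne'), indepSum]
  classical
  push_cast
  refine Finset.sum_congr rfl fun S _ => ?_
  simp only [Finset.prod_const]
  exact if_congr (regularMatroid_indep_iff A S).symm rfl rfl
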